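/- Throughout, $[A,B]$ denotes the subgroup generated by the commutators $[a,b]$ with $a\in A$, $b\in B$; $N^p$ denotes the subgroup generated by the $p$-th powers of the elements of $N$; and a bar denotes topological closure. Let $p$ be an odd prime. A pro-$p$ group $G$ is powerful if $[G,G]\le\overline{G^p}$, and a closed normal subgroup $N$ of $G$ is powerfully embedded in $G$ if $[N,G]\le\overline{N^p}$. Let $H$ be a pro-$p$ group, let $\gamma_1(H)=H$, $\gamma_{i+1}(H)=[\gamma_i(H),H]$ be its lower central series, and let $Z_0(H)=1$, $Z_1(H)=Z(H)$, $Z_2(H),\dots$ be its upper central series. Let $P_1(H)=H$, $P_{i+1}(H)=\overline{P_i(H)^p}\,\overline{[P_i(H),H]}$ be its lower $p$-series, and let $\Gamma_1(H)=H$, $\Gamma_{i+1}(H)=\overline{[\Gamma_i(H),\Gamma_i(H)]}$ (so that $\Gamma_i(H)$ is the closure of the $i$-th term of the derived series of $H$, counted from $H$ as the first term). For $i\ge 1$ let $$\mathcal D_i(H)=\{h\in H\mid [\dots[[h,x_1],x_2],\dots,x_i]=1\text{ for all }x_1\in\Gamma_1(H),\dots,x_i\in\Gamma_i(H)\},$$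 which is a closed normal subgroup of $H$. Then the following hold. (i) For every $n\ge 1$, if $H/Z_{n-1}(H)$ is powerful, then $\overline{\gamma_n(H)}$ is powerfully embedded in $H$. (ii) For every $n\ge 1$, if $H/Z_{n-1}(H)$ is powerful, then $P_n(H)$ is powerfully embedded in $H$. (iii) For every $n\ge 2$, if $H/\mathcal D_{n-1}(H)$ is powerful, then $\overline{\Gamma_n(H)}=\Gamma_n(H)$ is powerfully embedded in $H$. -/

import Mathlib

open scoped commutatorElement

/-- A profinite group is pro-`p` if the index of every open normal subgroup is a power of `p`. -/
class IsProP (p : ℕ) (G : Type*) [Group G] [TopologicalSpace G] [IsTopologicalGroup G] : Prop where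
  compact : CompactSpace G
  totallyDisconnected : TotallyDisconnectedSpace G
  index_eq_pow : ∀ U : Subgroup G, U.Normal → IsOpen (U : Set G) → ∃ k : ℕ, U.index = p ^ k

/-- The subgroup `N ^ m` generated by the `m`-th powers of the elements of `N`. -/
def powSubgroup {G : Type*} [Group G] (N : Subgroup G) (m : ℕ) : Subgroup G :=
  Subgroup.closure {y | ∃ x ∈ N, x ^ m = y}

/-- The exponent in the definition of powerful pro-`p` groups: `p` for `p` odd, and `4` for
`p = 2`. -/
def powerfulExponent (p : ℕ) : ℕ := if p = 2 then 4 else p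

/-- `G` is powerful: `[G, G]` lies in the closure of `G ^ p` (of `G ^ 4` if `p = 2`). -/
def IsPowerful (p : ℕ) (G : Type*) [Group G] [TopologicalSpace G] [IsTopologicalGroup G] : Prop :=
  ⁅(⊤ : Subgroup G), (⊤ : Subgroup G)⁆ ≤
    (powSubgroup (⊤ : Subgroup G) (powerfulExponent p)).topologicalClosure

/-- `N` is powerfully embedded in `G`: it is a closed normal subgroup, and `[N, G]` lies in the
closure of `N ^ p` (of `N ^ 4` if `p = 2`). -/
structure IsPowerfullyEmbedded (p : ℕ) {G : Type*} [Group G] [TopologicalSpace G]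
    [IsTopologicalGroup G] (N : Subgroup G) : Prop where
  isClosed : IsClosed (N : Set G)
  normal : N.Normal
  commutator_le :
    ⁅N, (⊤ : Subgroup G)⁆ ≤ (powSubgroup N (powerfulExponent p)).topologicalClosure

/-- The lower `p`-series, with the index starting at `0`: `lowerPSeries p G n` is `P_{n+1}(G)`,
where `P_1(G) = G`, and `P_{n+1}(G)` is the product of the closure of `P_n(G) ^ p` and the closure
of `[P_n(G), G]`. These two factors are normal, so that their product is their supremum. -/
def lowerPSeries (p : ℕ) (G : Type*) [Group G] [TopologicalSpace G] [IsTopologicalGroup G] :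
    ℕ → Subgroup G
  | 0 => ⊤
  | n + 1 => (powSubgroup (lowerPSeries p G n) p).topologicalClosure ⊔
      ⁅lowerPSeries p G n, (⊤ : Subgroup G)⁆.topologicalClosure

/-- The derived series with closures, with the index starting at `0`: `closedDerivedSeries G n` is
`Γ_{n+1}(G)`, where `Γ_1(G) = G`, and `Γ_{n+1}(G)` is the closure of `[Γ_n(G), Γ_n(G)]`. -/
def closedDerivedSeries (G : Type*) [Group G] [TopologicalSpace G] [IsTopologicalGroup G] :
    ℕ → Subgroup G
  | 0 => ⊤
  | n + 1 => ⁅closedDerivedSeries G n, closedDerivedSeries G n⁆.topologicalClosure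

/-- The left-normed commutator `[…[[h, x 0], x 1], …, x (n - 1)]`. -/
def leftCommutator {G : Type*} [Group G] (h : G) (x : ℕ → G) : ℕ → G
  | 0 => h
  | n + 1 => ⁅leftCommutator h x n, x n⁆

theorem closedDerivedSeries_normal (G : Type*) [Group G] [TopologicalSpace G]
    [IsTopologicalGroup G] (n : ℕ) : (closedDerivedSeries G n).Normal := by
  induction n with
  | zero => exact Subgroup.normal_of_characteristic ⊤
  | succ n ih => exact Subgroup.is_normal_topologicalClosure _

theorem leftCommutator_succ' {G : Type*} [Group G] (h : G) (x : ℕ → G) (n : ℕ) :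
    leftCommutator h x (n + 1) = leftCommutator ⁅h, x 0⁆ (fun i => x (i + 1)) n := by
  induction n with
  | zero => rfl
  | succ n ih => rw [leftCommutator, ih]; rfl

/-- The elements that are killed by left-normed commutators with entries in given normal subgroups
form a normal subgroup. -/
theorem exists_normal_leftCommutator {G : Type*} [Group G] (n : ℕ) :
    ∀ D : ℕ → Subgroup G, (∀ i, (D i).Normal) →
      ∃ K : Subgroup G, K.Normal ∧
        ∀ h, h ∈ K ↔ ∀ x : ℕ → G, (∀ i, x i ∈ D i) → leftCommutator h x n = 1 := by
  induction n with
  | zero =>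
    intro D _
    refine ⟨⊥, inferInstance, fun h => ?_⟩
    rw [Subgroup.mem_bot]
    exact ⟨fun hh _ _ => hh, fun hh => hh (fun _ => 1) fun i => (D i).one_mem⟩
  | succ n ih =>
    intro D hD
    obtain ⟨K, hK, hmem⟩ := ih (fun i => D (i + 1)) fun i => hD (i + 1)
    have hD0 := hD 0
    refine ⟨(Subgroup.centralizer
      ((D 0).map (QuotientGroup.mk' K) : Set (G ⧸ K))).comap (QuotientGroup.mk' K), ?_, ?_⟩
    · have : ((D 0).map (QuotientGroup.mk' K)).Normal :=
        hD0.map _ (QuotientGroup.mk'_surjective K)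
      exact Subgroup.Normal.comap inferInstance _
    · intro h
      have key : ∀ y : G, ⁅h, y⁆ ∈ K ↔
          (QuotientGroup.mk' K y) * (QuotientGroup.mk' K h) =
            (QuotientGroup.mk' K h) * (QuotientGroup.mk' K y) := by
        intro y
        rw [← QuotientGroup.eq_one_iff, ← QuotientGroup.mk'_apply, map_commutatorElement,
          commutatorElement_eq_one_iff_mul_comm, eq_comm]
      rw [Subgroup.mem_comap, Subgroup.mem_centralizer_iff]
      constructor
      · intro H x hx
        rw [leftCommutator_succ']
        exact (hmem _).1 ((key _).2 (H _ ⟨x 0, hx 0, rfl⟩)) _ fun i => hx (i + 1)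
      · rintro H _ ⟨y, hy, rfl⟩
        refine (key y).1 ((hmem _).2 fun x hx => ?_)
        have := H (fun i => Nat.casesOn i y x) (fun i => by cases i with
          | zero => exact hy
          | succ i => exact hx i)
        rwa [leftCommutator_succ'] at this

/-- The subgroup `𝒟_n(G)`, whose elements are the `h` such that `[…[[h, x_1], x_2], …, x_n] = 1`
for all `x_1 ∈ Γ_1(G), …, x_n ∈ Γ_n(G)`. -/
def derivedAnnihilator (G : Type*) [Group G] [TopologicalSpace G] [IsTopologicalGroup G] (n : ℕ) :
    Subgroup G where
  carrier := {h | ∀ x : ℕ → G, (∀ i, x i ∈ closedDerivedSeries G i) → leftCommutator h x n = 1}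
  one_mem' := by
    obtain ⟨K, -, h⟩ := exists_normal_leftCommutator n _ (closedDerivedSeries_normal G)
    exact (h _).1 K.one_mem
  mul_mem' := by
    obtain ⟨K, -, h⟩ := exists_normal_leftCommutator n _ (closedDerivedSeries_normal G)
    exact fun ha hb => (h _).1 (K.mul_mem ((h _).2 ha) ((h _).2 hb))
  inv_mem' := by
    obtain ⟨K, -, h⟩ := exists_normal_leftCommutator n _ (closedDerivedSeries_normal G)
    exact fun ha => (h _).1 (K.inv_mem ((h _).2 ha))

instance derivedAnnihilator_normal (G : Type*) [Group G] [TopologicalSpace G]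
    [IsTopologicalGroup G] (n : ℕ) : (derivedAnnihilator G n).Normal := by
  obtain ⟨K, hK, h⟩ := exists_normal_leftCommutator n _ (closedDerivedSeries_normal G)
  exact ⟨fun a ha g => (h _).1 (hK.conj_mem a ((h _).2 ha) g)⟩

/-! Let $E$ be the normal subgroup with $H/E$ powerful, $N_n$ the series in question and
$E_n=[E,D_0,\dots,D_{n-1}]$, where $D_i=H$, or $D_i=\Gamma_{i+1}(H)$ in (iii). Modulo an open normal
subgroup $U$, induction gives $[N_n,H]\le N_n^pE_nU$, and the choice of $E$ makes the final $E_n$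
trivial.

Two facts carry the induction. For odd $p$, `commutator_powSubgroup_le` moves $p$-th powers out of a
commutator at the cost of a term that here lies in $[[N_{n+1},H],H]$. Since $H/U$ is nilpotent,
`le_of_le_sup_commutator_top` discards that term. Letting $U$ vary gives the closure of $N_n^p$. -/

namespace Subgroup

/-! ### Commutator subgroups modulo a normal subgroup. -/

variable {G : Type*} [Group G]

theorem le_iff_map_mk'_eq_bot (A K : Subgroup G) [K.Normal] :
    A ≤ K ↔ A.map (QuotientGroup.mk' K) = ⊥ := by
  rw [map_eq_bot_iff, QuotientGroup.ker_mk']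

/-- Commuting modulo a normal subgroup `K` means lying in the preimage of a centralizer. -/
theorem commutator_le_iff_le_comap_centralizer (A C K : Subgroup G) [K.Normal] :
    ⁅A, C⁆ ≤ K ↔
      A ≤ (centralizer (C.map (QuotientGroup.mk' K) : Set (G ⧸ K))).comap
        (QuotientGroup.mk' K) := by
  rw [le_iff_map_mk'_eq_bot, map_commutator, commutator_eq_bot_iff_le_centralizer, map_le_iff_le_comap]

/-- Elements commuting with `C` modulo `K` form a subgroup, so neither `A` nor `B` need be normal.
-/
theorem commutator_sup_le {A B C K : Subgroup G} [K.Normal] (hA : ⁅A, C⁆ ≤ K) (hB : ⁅B, C⁆ ≤ K) :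
    ⁅A ⊔ B, C⁆ ≤ K := by
  rw [commutator_le_iff_le_comap_centralizer] at hA hB ⊢
  exact sup_le hA hB

/-- The three subgroups lemma modulo a normal subgroup. -/
theorem commutator_commutator_le_of_rotate {A B C K : Subgroup G} [K.Normal]
    (h₁ : ⁅⁅B, C⁆, A⁆ ≤ K) (h₂ : ⁅⁅C, A⁆, B⁆ ≤ K) : ⁅⁅A, B⁆, C⁆ ≤ K := by
  rw [le_iff_map_mk'_eq_bot, map_commutator, map_commutator] at h₁ h₂ ⊢
  exact commutator_commutator_eq_bot_of_rotate h₁ h₂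

/-- In a group that is nilpotent modulo `K`, a subgroup `M` with `M ≤ K ⊔ [M, G]` lies in `K`. -/
theorem le_of_le_sup_commutator_top {M K : Subgroup G} [K.Normal] {k : ℕ}
    (hk : (⊤ : Subgroup G).lowerCentralSeries k ≤ K) (h : M ≤ K ⊔ ⁅M, (⊤ : Subgroup G)⁆) :
    M ≤ K := by
  -- Feeding a bound on `M` back into `h` moves it one term down the lower central series.
  have key : ∀ n, M ≤ K ⊔ (⊤ : Subgroup G).lowerCentralSeries n := by
    intro n
    induction n with
    | zero => exact le_top.trans le_sup_right
    | succ n ih =>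
      refine h.trans (sup_le le_sup_left ((commutator_mono ih le_rfl).trans ?_))
      exact commutator_sup_le ((commutator_le_left _ _).trans le_sup_left) le_sup_right
  exact (key k).trans (sup_le le_rfl hk)

/-- The left-normed commutator subgroup `[…[[E, D 0], D 1], …, D (n - 1)]`. -/
def leftNormed (E : Subgroup G) (D : ℕ → Subgroup G) : ℕ → Subgroup G
  | 0 => E
  | n + 1 => ⁅leftNormed E D n, D n⁆

theorem leftNormed_normal {E : Subgroup G} (hE : E.Normal) {D : ℕ → Subgroup G}
    (hD : ∀ i, (D i).Normal) (n : ℕ) : (leftNormed E D n).Normal := by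
  induction n with
  | zero => exact hE
  | succ n ih =>
    have := hD n
    rw [leftNormed]
    infer_instance

theorem leftNormed_succ' (E : Subgroup G) (D : ℕ → Subgroup G) (n : ℕ) :
    leftNormed E D (n + 1) = leftNormed ⁅E, D 0⁆ (fun i => D (i + 1)) n := by
  induction n with
  | zero => rfl
  | succ n ih => rw [leftNormed, ih]; rfl

/-- Vanishing on elements passes to generated subgroups because the elements killed by the remaining
entries form a subgroup; hence the first entry is peeled off. -/
theorem leftNormed_eq_bot (n : ℕ) :
    ∀ (E : Subgroup G) (D : ℕ → Subgroup G), (∀ i, (D i).Normal) →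
      (∀ h ∈ E, ∀ x : ℕ → G, (∀ i, x i ∈ D i) → leftCommutator h x n = 1) →
      leftNormed E D n = ⊥ := by
  induction n with
  | zero =>
    intro E D _ h
    exact (eq_bot_iff_forall E).2 fun y hy => h y hy (fun _ => 1) fun i => (D i).one_mem
  | succ n ih =>
    intro E D hD h
    rw [leftNormed_succ']
    obtain ⟨K, -, hK⟩ := exists_normal_leftCommutator n (fun i => D (i + 1)) fun i => hD (i + 1)
    have hle : ⁅E, D 0⁆ ≤ K := by
      refine commutator_le.2 fun a ha b hb => (hK _).2 fun x hx => ?_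
      have := h a ha (fun i => Nat.casesOn i b x) (fun i => by cases i with
        | zero => exact hb
        | succ i => exact hx i)
      rwa [leftCommutator_succ'] at this
    exact ih _ _ (fun i => hD (i + 1)) fun y hy => (hK y).1 (hle hy)

theorem leftNormed_derivedAnnihilator_eq_bot (G : Type*) [Group G] [TopologicalSpace G]
    [IsTopologicalGroup G] (n : ℕ) :
    leftNormed (derivedAnnihilator G n) (closedDerivedSeries G) n = ⊥ :=
  leftNormed_eq_bot n _ _ (closedDerivedSeries_normal G) fun _ hh => hh

theorem leftNormed_upperCentralSeries_eq_bot (G : Type*) [Group G] (n : ℕ) :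
    leftNormed (upperCentralSeries G n) (fun _ => ⊤) n = ⊥ := by
  -- The offset `m` must stay free, since the starting term depends on `k`.
  have key : ∀ k m, leftNormed (upperCentralSeries G (m + k)) (fun _ => ⊤) k ≤
      upperCentralSeries G m := by
    intro k
    induction k with
    | zero => exact fun m => le_rfl
    | succ k ih =>
      intro m
      refine le_trans (commutator_mono ?_ le_rfl) (commutator_upperCentralSeries_top_le G m)
      rw [show m + (k + 1) = m + 1 + k by omega]
      exact ih (m + 1)
  have := key n 0
  rwa [zero_add, upperCentralSeries_zero, le_bot_iff] at this

end Subgroup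

/-! ### Powers and commutators. -/

section Power

variable {G : Type*} [Group G]

theorem pow_mem_powSubgroup {N : Subgroup G} {x : G} (hx : x ∈ N) (m : ℕ) :
    x ^ m ∈ powSubgroup N m :=
  Subgroup.subset_closure ⟨x, hx, rfl⟩

theorem powSubgroup_le_iff {N K : Subgroup G} {m : ℕ} :
    powSubgroup N m ≤ K ↔ ∀ x ∈ N, x ^ m ∈ K := by
  refine ⟨fun h x hx => h (pow_mem_powSubgroup hx m), fun h => (Subgroup.closure_le K).2 ?_⟩
  rintro _ ⟨x, hx, rfl⟩
  exact h x hx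

theorem powSubgroup_mono {N M : Subgroup G} (h : N ≤ M) (m : ℕ) :
    powSubgroup N m ≤ powSubgroup M m :=
  powSubgroup_le_iff.2 fun _ hx => pow_mem_powSubgroup (h hx) m

instance powSubgroup_normal (N : Subgroup G) [hN : N.Normal] (m : ℕ) : (powSubgroup N m).Normal := by
  refine ⟨fun a ha g => ?_⟩
  have : powSubgroup N m ≤ (powSubgroup N m).comap (MulAut.conj g).toMonoidHom := by
    refine powSubgroup_le_iff.2 fun x hx => ?_
    rw [Subgroup.mem_comap, map_pow]
    exact pow_mem_powSubgroup (hN.conj_mem x hx g) m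
  exact this ha

/-- Conjugation by `x` turns `c ^ n` into `d ^ n * c ^ n`, so the exponent of `d` grows by `n` at
each step and sums to `n.choose 2`. -/
theorem pow_conj_eq_of_commute {x y c d : G} (hc : x * c * x⁻¹ = d * c) (hxd : Commute x d)
    (hcd : Commute c d) (hy : x * y * x⁻¹ = c * y) (n : ℕ) :
    x ^ n * y * (x ^ n)⁻¹ = c ^ n * d ^ n.choose 2 * y := by
  induction n with
  | zero => simp
  | succ n ih =>
    have e₁ : x * c ^ n * x⁻¹ = d ^ n * c ^ n := by
      rw [← conj_pow, hc, hcd.symm.mul_pow]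
    have e₂ : x * d ^ n.choose 2 * x⁻¹ = d ^ n.choose 2 := by
      rw [(hxd.pow_right _).eq, mul_inv_cancel_right]
    calc x ^ (n + 1) * y * (x ^ (n + 1))⁻¹ = x * (x ^ n * y * (x ^ n)⁻¹) * x⁻¹ := by
          rw [pow_succ']; group
      _ = (x * c ^ n * x⁻¹) * (x * d ^ n.choose 2 * x⁻¹) * (x * y * x⁻¹) := by
          rw [ih]; group
      _ = d ^ n * (c ^ n * d ^ n.choose 2) * (c * y) := by
          rw [e₁, e₂, hy]; group
      _ = c ^ (n + 1) * d ^ (n + 1).choose 2 * y := by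
          have h₁ := (hcd.pow_pow n n).eq
          have h₂ := (hcd.pow_right (n.choose 2)).eq
          rw [Nat.choose_succ_succ' n 1, Nat.choose_one_right, pow_add d, pow_succ c]
          calc d ^ n * (c ^ n * d ^ n.choose 2) * (c * y)
              = (d ^ n * c ^ n) * (d ^ n.choose 2 * c) * y := by group
            _ = c ^ n * d ^ n * (c * d ^ n.choose 2) * y := by rw [← h₁, ← h₂]
            _ = c ^ n * (d ^ n * c) * d ^ n.choose 2 * y := by group
            _ = c ^ n * (c * d ^ n) * d ^ n.choose 2 * y := by rw [(hcd.pow_right n).eq]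
            _ = c ^ n * c * (d ^ n * d ^ n.choose 2) * y := by simp only [mul_assoc]

/-- For `p` odd, `[N ^ p, M]` lies in `[N, M] ^ p` modulo `[[[N, M], N], N]`. -/
theorem commutator_powSubgroup_le {p : ℕ} (hp : p.Prime) (hodd : Odd p) (N M : Subgroup G)
    [N.Normal] [M.Normal] :
    ⁅powSubgroup N p, M⁆ ≤ powSubgroup ⁅N, M⁆ p ⊔ ⁅⁅⁅N, M⁆, N⁆, N⁆ := by
  set K := powSubgroup ⁅N, M⁆ p ⊔ ⁅⁅⁅N, M⁆, N⁆, N⁆ with hK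
  rw [Subgroup.commutator_le_iff_le_comap_centralizer, powSubgroup_le_iff]
  intro x hx
  rw [Subgroup.mem_comap, Subgroup.mem_centralizer_iff]
  rintro _ ⟨y, hy, rfl⟩
  have hc : ⁅x, y⁆ ∈ ⁅N, M⁆ := Subgroup.commutator_mem_commutator hx hy
  have hcN : ⁅x, y⁆ ∈ N := Subgroup.commutator_le_left N M hc
  have hd : ⁅x, ⁅x, y⁆⁆ ∈ ⁅⁅N, M⁆, N⁆ := by
    rw [Subgroup.commutator_comm]
    exact Subgroup.commutator_mem_commutator hx hc
  have hd' : ⁅x, ⁅x, y⁆⁆ ∈ ⁅N, M⁆ := Subgroup.commutator_le_left _ N hd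
  have hpow : ∀ g ∈ ⁅N, M⁆, (QuotientGroup.mk' K g) ^ p = 1 := by
    intro g hg
    rw [← map_pow, QuotientGroup.mk'_apply, QuotientGroup.eq_one_iff]
    exact Subgroup.mem_sup_left (pow_mem_powSubgroup hg p)
  have hcomm : ∀ z ∈ N, Commute (QuotientGroup.mk' K z) (QuotientGroup.mk' K ⁅x, ⁅x, y⁆⁆) := by
    intro z hz
    rw [← commutatorElement_eq_one_iff_commute, ← map_commutatorElement, QuotientGroup.mk'_apply,
      QuotientGroup.eq_one_iff]
    refine Subgroup.mem_sup_right ?_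
    rw [Subgroup.commutator_comm]
    exact Subgroup.commutator_mem_commutator hz hd
  have h := pow_conj_eq_of_commute (x := QuotientGroup.mk' K x) (y := QuotientGroup.mk' K y)
    (c := QuotientGroup.mk' K ⁅x, y⁆) (d := QuotientGroup.mk' K ⁅x, ⁅x, y⁆⁆)
    (by simp only [commutatorElement_def, map_mul, map_inv]; group)
    (hcomm x hx) (hcomm _ hcN)
    (by simp only [commutatorElement_def, map_mul, map_inv]; group) p
  -- Oddness enters here: the exponent of $d=[x,[x,y]]$ is a multiple of $p$, and $d\in[N,M]$ has
  -- trivial $p$-th power modulo `K`.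
  obtain ⟨m, hm⟩ : p ∣ p.choose 2 := by
    refine hp.dvd_choose_self two_ne_zero (lt_of_le_of_ne hp.two_le ?_)
    rintro rfl
    exact absurd hodd (by decide)
  rw [hm, pow_mul, hpow _ hc, hpow _ hd', one_pow, one_mul, one_mul, mul_inv_eq_iff_eq_mul] at h
  rw [map_pow, h]

end Power

/-! ### The three inductions modulo an open normal subgroup. -/

section Series

open Subgroup

variable {G : Type*} [Group G] {p : ℕ} {E U : Subgroup G} [E.Normal] [U.Normal] {k : ℕ}

theorem commutator_lowerCentralSeries_le (hp : p.Prime) (hodd : Odd p)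
    (hk : (⊤ : Subgroup G).lowerCentralSeries k ≤ U)
    (hE : ⁅(⊤ : Subgroup G), (⊤ : Subgroup G)⁆ ≤ powSubgroup ⊤ p ⊔ E ⊔ U) (n : ℕ) :
    ⁅(⊤ : Subgroup G).lowerCentralSeries n, (⊤ : Subgroup G)⁆ ≤
      powSubgroup ((⊤ : Subgroup G).lowerCentralSeries n) p ⊔ leftNormed E (fun _ => ⊤) n ⊔ U := by
  have hnormal := leftNormed_normal (E := E) inferInstance (D := fun _ => ⊤) fun _ => inferInstance
  induction n with
  | zero => exact hE
  | succ n ih =>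
    have := hnormal (n + 1)
    -- It now suffices to bound the commutator up to $[[\gamma,H],H]$, with $\gamma$ the next term
    -- of the series.
    refine le_of_le_sup_commutator_top (hk.trans le_sup_right) ?_
    rw [Subgroup.lowerCentralSeries_succ]
    refine (commutator_mono ih le_rfl).trans (commutator_sup_le (commutator_sup_le ?_ ?_) ?_)
    · refine (commutator_powSubgroup_le hp hodd _ _).trans (sup_le ?_ ?_)
      · exact le_sup_left.trans (le_sup_left.trans le_sup_left)
      · exact (commutator_mono (commutator_mono le_rfl le_top) le_top).trans le_sup_right
    · exact le_sup_right.trans (le_sup_left.trans le_sup_left)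
    · exact (commutator_le_left _ _).trans (le_sup_right.trans le_sup_left)

variable [TopologicalSpace G] [IsTopologicalGroup G]

/-- `A ⊔ U` is an open subgroup, hence closed. Modulo `U`, closures can thus be dropped. -/
theorem topologicalClosure_le_sup {G : Type*} [Group G] [TopologicalSpace G]
    [IsTopologicalGroup G] (A : Subgroup G) {U : Subgroup G} (hU : IsOpen (U : Set G)) :
    A.topologicalClosure ≤ A ⊔ U :=
  topologicalClosure_minimal _ le_sup_left
    (isClosed_of_isOpen _ (isOpen_mono le_sup_right hU))

theorem lowerPSeries_normal (p : ℕ) (G : Type*) [Group G] [TopologicalSpace G]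
    [IsTopologicalGroup G] (n : ℕ) : (lowerPSeries p G n).Normal := by
  induction n with
  | zero => exact normal_of_characteristic ⊤
  | succ n ih =>
    have h₁ := is_normal_topologicalClosure (powSubgroup (lowerPSeries p G n) p)
    have h₂ := is_normal_topologicalClosure ⁅lowerPSeries p G n, (⊤ : Subgroup G)⁆
    exact sup_normal _ _

/-- Both factors of $P_{i+1}$ reduce to $[P_i^p,G]$: the induction hypothesis bounds $[[P_i,G],G]$
by it, up to $E$- and $U$-terms. -/
theorem commutator_lowerPSeries_le (hp : p.Prime) (hodd : Odd p) (hU : IsOpen (U : Set G))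
    (hk : (⊤ : Subgroup G).lowerCentralSeries k ≤ U)
    (hE : ⁅(⊤ : Subgroup G), (⊤ : Subgroup G)⁆ ≤ powSubgroup ⊤ p ⊔ E ⊔ U) (n : ℕ) :
    ⁅lowerPSeries p G n, (⊤ : Subgroup G)⁆ ≤
      powSubgroup (lowerPSeries p G n) p ⊔ leftNormed E (fun _ => ⊤) n ⊔ U := by
  have hnormal := leftNormed_normal (E := E) inferInstance (D := fun _ => ⊤) fun _ => inferInstance
  induction n with
  | zero => exact hE
  | succ n ih =>
    have := hnormal (n + 1)
    have := lowerPSeries_normal p G n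
    have := lowerPSeries_normal p G (n + 1)
    refine le_of_le_sup_commutator_top (hk.trans le_sup_right) ?_
    have hle : ⁅lowerPSeries p G n, (⊤ : Subgroup G)⁆ ≤ lowerPSeries p G (n + 1) :=
      (le_topologicalClosure _).trans le_sup_right
    have hUle : ⁅U, (⊤ : Subgroup G)⁆ ≤ U := commutator_le_left _ _
    set K := powSubgroup (lowerPSeries p G (n + 1)) p ⊔ leftNormed E (fun _ => ⊤) (n + 1) ⊔ U ⊔
      ⁅⁅lowerPSeries p G (n + 1), (⊤ : Subgroup G)⁆, (⊤ : Subgroup G)⁆ with hK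
    have hUK : ⁅U, (⊤ : Subgroup G)⁆ ≤ K := hUle.trans (le_sup_right.trans le_sup_left)
    have hpow : ⁅powSubgroup (lowerPSeries p G n) p, (⊤ : Subgroup G)⁆ ≤ K := by
      refine (commutator_powSubgroup_le hp hodd _ _).trans (sup_le ?_ ?_)
      · exact (powSubgroup_mono hle p).trans (le_sup_left.trans (le_sup_left.trans le_sup_left))
      · exact (commutator_mono (commutator_mono hle le_top) le_top).trans le_sup_right
    have hcomm : ⁅⁅lowerPSeries p G n, (⊤ : Subgroup G)⁆, (⊤ : Subgroup G)⁆ ≤ K := by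
      refine (commutator_mono ih le_rfl).trans (commutator_sup_le (commutator_sup_le hpow ?_) hUK)
      exact le_sup_right.trans (le_sup_left.trans le_sup_left)
    have hsucc : lowerPSeries p G (n + 1) ≤
        (powSubgroup (lowerPSeries p G n) p ⊔ U) ⊔
          (⁅lowerPSeries p G n, (⊤ : Subgroup G)⁆ ⊔ U) :=
      sup_le_sup (topologicalClosure_le_sup _ hU) (topologicalClosure_le_sup _ hU)
    exact (commutator_mono hsucc le_rfl).trans
      (commutator_sup_le (commutator_sup_le hpow hUK) (commutator_sup_le hcomm hUK))

theorem commutator_closedDerivedSeries_le (hp : p.Prime) (hodd : Odd p) (hU : IsOpen (U : Set G))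
    (hk : (⊤ : Subgroup G).lowerCentralSeries k ≤ U)
    (hE : ⁅(⊤ : Subgroup G), (⊤ : Subgroup G)⁆ ≤ powSubgroup ⊤ p ⊔ E ⊔ U) (n : ℕ) :
    ⁅closedDerivedSeries G n, (⊤ : Subgroup G)⁆ ≤
      powSubgroup (closedDerivedSeries G n) p ⊔ leftNormed E (closedDerivedSeries G) n ⊔ U := by
  have hnormal := leftNormed_normal (E := E) inferInstance (closedDerivedSeries_normal G)
  induction n with
  | zero => exact hE
  | succ n ih =>
    have := hnormal (n + 1)
    have := closedDerivedSeries_normal G n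
    have := closedDerivedSeries_normal G (n + 1)
    refine le_of_le_sup_commutator_top (hk.trans le_sup_right) ?_
    have hle : ⁅closedDerivedSeries G n, closedDerivedSeries G n⁆ ≤ closedDerivedSeries G (n + 1) :=
      le_topologicalClosure _
    set K := powSubgroup (closedDerivedSeries G (n + 1)) p ⊔
      leftNormed E (closedDerivedSeries G) (n + 1) ⊔ U ⊔
      ⁅⁅closedDerivedSeries G (n + 1), (⊤ : Subgroup G)⁆, (⊤ : Subgroup G)⁆ with hK
    have hUK : U ≤ K := le_sup_right.trans le_sup_left
    have hpow : ⁅powSubgroup (closedDerivedSeries G n) p, closedDerivedSeries G n⁆ ≤ K := by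
      refine (commutator_powSubgroup_le hp hodd _ _).trans (sup_le ?_ ?_)
      · exact (powSubgroup_mono hle p).trans (le_sup_left.trans (le_sup_left.trans le_sup_left))
      · exact (commutator_mono (commutator_mono hle le_top) le_top).trans le_sup_right
    have hcomm : ⁅⁅closedDerivedSeries G n, (⊤ : Subgroup G)⁆, closedDerivedSeries G n⁆ ≤ K := by
      refine (commutator_mono ih le_rfl).trans
        (commutator_sup_le (commutator_sup_le hpow ?_) ((commutator_le_left _ _).trans hUK))
      exact le_sup_right.trans (le_sup_left.trans le_sup_left)
    have hsucc : closedDerivedSeries G (n + 1) ≤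
        ⁅closedDerivedSeries G n, closedDerivedSeries G n⁆ ⊔ U :=
      topologicalClosure_le_sup _ hU
    refine (commutator_mono hsucc le_rfl).trans
      (commutator_sup_le ?_ ((commutator_le_left _ _).trans hUK))
    -- By three subgroups, $[[\Gamma,\Gamma],G]$ is controlled by $[[\Gamma,G],\Gamma]$ alone, as
    -- both rotations coincide. This is why the next entry of `leftNormed` is $\Gamma$, not $G$.
    refine commutator_commutator_le_of_rotate hcomm ?_
    rwa [commutator_comm ⊤]

end Series

/-! ### Passage to pro-$p$ groups. -/

section ProP

open Subgroup

variable {p : ℕ} {H : Type*} [Group H] [TopologicalSpace H] [IsTopologicalGroup H]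

/-- A pro-`p` group is nilpotent modulo every open normal subgroup. -/
theorem IsProP.exists_lowerCentralSeries_le [hp : Fact p.Prime] [hH : IsProP p H] (U : Subgroup H)
    [hn : U.Normal] (hU : IsOpen (U : Set H)) :
    ∃ k, (⊤ : Subgroup H).lowerCentralSeries k ≤ U := by
  obtain ⟨m, hm⟩ := hH.index_eq_pow U hn hU
  have hcard : Nat.card (H ⧸ U) = p ^ m := hm
  have : Finite (H ⧸ U) := Nat.finite_of_card_ne_zero (by
    rw [hcard]; exact pow_ne_zero _ hp.out.ne_zero)
  obtain ⟨k, hk⟩ := Subgroup.nilpotent_iff_lowerCentralSeries.1 (IsPGroup.of_card hcard).isNilpotent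
  refine ⟨k, (le_iff_map_mk'_eq_bot _ _).2 ?_⟩
  rw [map_lowerCentralSeries, map_top_of_surjective _ (QuotientGroup.mk'_surjective U), hk]

/-- In a profinite group the closure of `A` is the intersection of the subgroups `A ⊔ U`, for `U`
open and normal. -/
theorem le_topologicalClosure_of_forall_le_sup [CompactSpace H] [TotallyDisconnectedSpace H]
    {A B : Subgroup H}
    (h : ∀ U : Subgroup H, U.Normal → IsOpen (U : Set H) → B ≤ A ⊔ U) :
    B ≤ A.topologicalClosure := by
  intro b hb
  rw [← SetLike.mem_coe, topologicalClosure_coe, mem_closure_iff_nhds_one]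
  intro V hV
  obtain ⟨W, hWV, hW, h1⟩ := mem_nhds_iff.1 hV
  obtain ⟨U, hUW⟩ := ProfiniteGrp.exist_openNormalSubgroup_sub_open_nhds_of_one hW h1
  have hUn : U.toSubgroup.Normal := U.isNormal'
  have hbU := h U.toSubgroup hUn U.isOpen' hb
  rw [sup_comm] at hbU
  obtain ⟨u, hu, a, ha, rfl⟩ := mem_sup_of_normal_left.1 hbU
  refine ⟨a, ha, hWV (hUW ?_)⟩
  rw [div_eq_mul_inv, mul_inv_rev, mul_inv_cancel_left]
  exact U.toSubgroup.inv_mem hu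

theorem powerfulExponent_of_odd (hp : Odd p) : powerfulExponent p = p := by
  refine if_neg ?_
  rintro rfl
  exact absurd hp (by decide)

/-- The image of `U` in `H ⧸ E` is open and absorbs the closure; pulling back adds only `E`. -/
theorem IsPowerful.commutator_top_le (hp : Odd p) {E : Subgroup H} [E.Normal]
    (h : IsPowerful p (H ⧸ E)) (U : Subgroup H) [hUn : U.Normal] (hU : IsOpen (U : Set H)) :
    ⁅(⊤ : Subgroup H), (⊤ : Subgroup H)⁆ ≤ powSubgroup ⊤ p ⊔ E ⊔ U := by
  have hopen : IsOpen (U.map (QuotientGroup.mk' E) : Set (H ⧸ E)) :=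
    QuotientGroup.isOpenMap_coe _ hU
  have hnormal : (U.map (QuotientGroup.mk' E)).Normal :=
    hUn.map _ (QuotientGroup.mk'_surjective E)
  have hpow : powSubgroup (⊤ : Subgroup (H ⧸ E)) p ≤
      (powSubgroup (⊤ : Subgroup H) p).map (QuotientGroup.mk' E) := by
    refine powSubgroup_le_iff.2 fun x _ => ?_
    obtain ⟨y, rfl⟩ := QuotientGroup.mk'_surjective E x
    exact ⟨y ^ p, pow_mem_powSubgroup (mem_top y) p, map_pow _ _ _⟩
  rw [IsPowerful, powerfulExponent_of_odd hp] at h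
  have h' := (h.trans (topologicalClosure_le_sup _ hopen)).trans (sup_le_sup_right hpow _)
  rw [← Subgroup.map_sup, ← map_top_of_surjective _ (QuotientGroup.mk'_surjective E), ← map_commutator,
    map_le_iff_le_comap, QuotientGroup.comap_map_mk'] at h'
  refine h'.trans (sup_le ?_ (sup_le ?_ ?_))
  · exact le_sup_right.trans le_sup_left
  · exact le_sup_left.trans le_sup_left
  · exact le_sup_right

/-- To show that the closure of `N` is powerfully embedded, one may work modulo the open normal
subgroups. -/
theorem isPowerfullyEmbedded_topologicalClosure [hH : IsProP p H] (hp : Odd p) (N : Subgroup H)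
    [hN : N.Normal]
    (h : ∀ U : Subgroup H, U.Normal → IsOpen (U : Set H) →
      ⁅N, (⊤ : Subgroup H)⁆ ≤ powSubgroup N p ⊔ U) :
    IsPowerfullyEmbedded p N.topologicalClosure := by
  have := hH.compact
  have := hH.totallyDisconnected
  refine ⟨isClosed_topologicalClosure N, is_normal_topologicalClosure N, ?_⟩
  rw [powerfulExponent_of_odd hp]
  refine le_topologicalClosure_of_forall_le_sup fun U hUn hU => ?_
  have := is_normal_topologicalClosure N
  refine (commutator_mono (topologicalClosure_le_sup N hU) le_rfl).trans (commutator_sup_le ?_ ?_)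
  · exact (h U hUn hU).trans (sup_le_sup_right (powSubgroup_mono (le_topologicalClosure N) p) _)
  · exact (commutator_le_left _ _).trans le_sup_right

/-- The supremum is a product of a compact set and a closed set. -/
theorem isClosed_lowerPSeries [CompactSpace H] (p n : ℕ) :
    IsClosed (lowerPSeries p H n : Set H) := by
  cases n with
  | zero => exact isClosed_univ
  | succ n =>
    have := lowerPSeries_normal p H n
    have h₁ := is_normal_topologicalClosure (powSubgroup (lowerPSeries p H n) p)
    rw [lowerPSeries, normal_mul]
    have c₁ := isClosed_topologicalClosure (powSubgroup (lowerPSeries p H n) p)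
    have c₂ := isClosed_topologicalClosure ⁅lowerPSeries p H n, (⊤ : Subgroup H)⁆
    exact c₂.mul_left_of_isCompact c₁.isCompact

end ProP

theorem theoremA (p : ℕ) [Fact p.Prime] (hp : Odd p)
    (H : Type*) [Group H] [TopologicalSpace H] [IsTopologicalGroup H] [IsProP p H] :
    (∀ n : ℕ, 1 ≤ n → IsPowerful p (H ⧸ Subgroup.upperCentralSeries H (n - 1)) →
      IsPowerfullyEmbedded p ((⊤ : Subgroup H).lowerCentralSeries (n - 1)).topologicalClosure) ∧
    (∀ n : ℕ, 1 ≤ n → IsPowerful p (H ⧸ Subgroup.upperCentralSeries H (n - 1)) →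
      IsPowerfullyEmbedded p (lowerPSeries p H (n - 1))) ∧
    (∀ n : ℕ, 2 ≤ n → IsPowerful p (H ⧸ derivedAnnihilator H (n - 1)) →
      IsPowerfullyEmbedded p (closedDerivedSeries H (n - 1)).topologicalClosure) := by
  have hprime : p.Prime := Fact.out
  have hcompact : CompactSpace H := IsProP.compact p
  refine ⟨fun n _ h => ?_, fun n _ h => ?_, fun n _ h => ?_⟩
  · refine isPowerfullyEmbedded_topologicalClosure hp _ fun U hUn hU => ?_
    obtain ⟨k, hk⟩ := IsProP.exists_lowerCentralSeries_le (p := p) U hU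
    have := commutator_lowerCentralSeries_le hprime hp hk (h.commutator_top_le hp U hU) (n - 1)
    rwa [Subgroup.leftNormed_upperCentralSeries_eq_bot, sup_bot_eq] at this
  · have hnormal := lowerPSeries_normal p H (n - 1)
    -- Being closed, $P_n$ equals its closure, so the criterion for closures applies.
    rw [← le_antisymm
      (Subgroup.topologicalClosure_minimal _ le_rfl (isClosed_lowerPSeries p (n - 1)))
      (Subgroup.le_topologicalClosure _)]
    refine isPowerfullyEmbedded_topologicalClosure hp _ fun U hUn hU => ?_
    obtain ⟨k, hk⟩ := IsProP.exists_lowerCentralSeries_le (p := p) U hU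
    have := commutator_lowerPSeries_le hprime hp hU hk (h.commutator_top_le hp U hU) (n - 1)
    rwa [Subgroup.leftNormed_upperCentralSeries_eq_bot, sup_bot_eq] at this
  · have hnormal := closedDerivedSeries_normal H (n - 1)
    refine isPowerfullyEmbedded_topologicalClosure hp _ fun U hUn hU => ?_
    obtain ⟨k, hk⟩ := IsProP.exists_lowerCentralSeries_le (p := p) U hU
    have := commutator_closedDerivedSeries_le hprime hp hU hk (h.commutator_top_le hp U hU) (n - 1)
    rwa [Subgroup.leftNormed_derivedAnnihilator_eq_bot, sup_bot_eq] at this
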